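/- Let $(E,\rho)$ be a complete separable metric space with Borel $\sigma$-algebra $\mathcal E$, and let $P(x,dy)$ be a Markov transition kernel on $(E,\mathcal E)$ with $n$-step transition probabilities $P_n(x,dy)$. For $x\in E$ let $\mathbb P_x$ be the law on $(E^{\mathbb Z_+},\mathcal E^{\otimes\infty})$ of the Markov chain with transition kernel $P$ started at $x$. A probability measure $\mu$ on $E$ is invariant if $\int_E P(x,\cdot)\,\mu(dx)=\mu$. For probability measures $\mathbb P,\mathbb Q$ on $E^{\mathbb Z_+}$ let $\widehat C(\mathbb P,\mathbb Q)$ be the set of all probability measures $\xi$ on $E^{\mathbb Z_+}\times E^{\mathbb Z_+}$ whose marginals satisfy $\pi_1(\xi)\ll\mathbb P$ and $\pi_2(\xi)\ll\mathbb Q$; the coordinate processes on $E^{\mathbb Z_+}\times E^{\mathbb Z_+}$ are denoted by $(X_n)_{n\ge 0}$ and $(Y_n)_{n\ge 0}$. Let $d$ be a second metric on $E$ which is bounded and is continuous with respect to $\rho$ (as a function on $E\times E$). Let $\overline E^d\supseteq E$ be the completion of $E$ with respect to $d$, and assume that for every $y\in E$ there are $d$-continuous functions $\rho^y_n:\overline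 E^d\to[0,\infty)$, $n\ge 1$, such that, as $n\to\infty$, $\rho^y_n(x)\to\rho(x,y)$ for $x\in E$ and $\rho^y_n(x)\to\infty$ for $x\in\overline E^d\setminus E$. (This holds automatically if $d=\rho$.) Assume that the chain is $d$-Feller, i.e. for every bounded $d$-continuous $f:E\to\mathbb R$ the function $x\mapsto\int_E f(y)\,P(x,dy)$ is $d$-continuous. Assume also that for every $(x,y)\in E\times E$ there exists $\xi_{x,y}\in\widehat C(\mathbb P_x,\mathbb P_y)$ such that $\pi_1(\xi_{x,y})$ and $\mathbb P_x$ are mutually absolutely continuous and $$\lim_{n\to\infty}\xi_{x,y}\big(d(X_n,Y_n)\le\varepsilon\big)=1\qquad\text{for every }\varepsilon>0 .$$ Then there is at most one invariant probability measure, and if an invariant probability measure $\mu$ exists, then for every $x\in E$ the measures $P_n(x,\cdot)$ converge to $\mu$ weakly with respect to $d$, i.e. $\int_E f(y)\,P_n(x,dy)\to\int_E f\,d\mu$ for every bounded $d$-continuous $f:E\to\mathbb R$. -/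

import Mathlib

open MeasureTheory ProbabilityTheory Filter
open scoped Topology

/-- The law `ℙ_x` on the path space `E^ℕ` of the Markov chain with one-step transition kernel `P`
started at `x`: the Ionescu-Tulcea measure in which, given the states at times `0, …, n`, the state
at time `n + 1` has law `P (x n)`. -/
noncomputable def pathLaw {E : Type*} [MeasurableSpace E] (P : Kernel E E) [IsMarkovKernel P]
    (x : E) : Measure (ℕ → E) :=
  Kernel.traj (X := fun _ => E)
    (fun n => P.comap (fun h : Finset.Iic n → E => h ⟨n, Finset.mem_Iic.2 le_rfl⟩)
      (measurable_pi_apply _)) 0 (fun _ => x)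

/-- The class `Ĉ(μ, ν)` of generalized couplings: probability measures on `S × S` whose first
marginal is absolutely continuous with respect to `μ` and whose second marginal is absolutely
continuous with respect to `ν`. -/
def generalizedCouplings {S : Type*} [MeasurableSpace S] (μ ν : Measure S) :
    Set (Measure (S × S)) :=
  {ξ | IsProbabilityMeasure ξ ∧ ξ.fst ≪ μ ∧ ξ.snd ≪ ν}

/-- A metric on the set `E`. (This is deliberately not a type class, so that it never interferes with
the metric, the topology and the Borel sets which `E` carries as instances.) -/
structure MetricOn (E : Type*) where
  dist : E → E → ℝ
  dist_self : ∀ x, dist x x = 0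
  eq_of_dist_eq_zero : ∀ {x y}, dist x y = 0 → x = y
  dist_comm : ∀ x y, dist x y = dist y x
  dist_triangle : ∀ x y z, dist x z ≤ dist x y + dist y z

/-- A copy of the set `E`, regarded as a metric space with the metric `d`. -/
@[ext]
structure WithMetric (E : Type*) (d : MetricOn E) where
  of ::
  val : E

noncomputable instance WithMetric.instMetricSpace (E : Type*) (d : MetricOn E) :
    MetricSpace (WithMetric E d) where
  dist x y := d.dist x.val y.val
  dist_self x := d.dist_self x.val
  dist_comm x y := d.dist_comm x.val y.val
  dist_triangle x y z := d.dist_triangle x.val y.val z.val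
  eq_of_dist_eq_zero h := WithMetric.ext (d.eq_of_dist_eq_zero h)

/-- A point of `E` as a point of the completion of `E` with respect to the metric `d`. -/
noncomputable def toCompletion {E : Type*} (d : MetricOn E) (x : E) :
    UniformSpace.Completion (WithMetric E d) :=
  ((WithMetric.of x : WithMetric E d) : UniformSpace.Completion (WithMetric E d))

/-- A real function on `E` which is bounded and continuous with respect to the metric `d`. -/
def IsBoundedContinuousFor {E : Type*} (d : MetricOn E) (f : E → ℝ) : Prop :=
  (∃ C : ℝ, ∀ x, |f x| ≤ C) ∧ Continuous (fun x : WithMetric E d => f x.val)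

/-- The standing assumptions on the second metric `d` on the metric space `(E, ρ)` (here `ρ` is
the instance metric): `d` is bounded, `d` is continuous with respect to `ρ`, and for every `y : E`
there are `d`-continuous functions `g n : Ē → [0, ∞)` on the `d`-completion `Ē` of `E` which
converge pointwise to `ρ (·, y)` on `E` and to `∞` outside `E`. -/
structure IsAdmissibleMetric {E : Type*} [MetricSpace E] (d : MetricOn E) : Prop where
  bounded : ∃ C : ℝ, ∀ x y : E, d.dist x y ≤ C
  continuous : Continuous (fun p : E × E => d.dist p.1 p.2)
  approx : ∀ y : E, ∃ g : ℕ → UniformSpace.Completion (WithMetric E d) → ℝ,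
    (∀ n, Continuous (g n)) ∧ (∀ n z, 0 ≤ g n z) ∧
    (∀ x : E, Tendsto (fun n => g n (toCompletion d x)) atTop (𝓝 (dist x y))) ∧
    (∀ z, z ∉ Set.range (toCompletion d) → Tendsto (fun n => g n z) atTop atTop)

/-- The chain with transition kernel `P` is `d`-Feller: `P` maps bounded `d`-continuous functions
to `d`-continuous functions. -/
def IsFellerFor {E : Type*} [MeasurableSpace E] (d : MetricOn E) (P : Kernel E E) : Prop :=
  ∀ f : E → ℝ, IsBoundedContinuousFor d f →
    Continuous (fun x : WithMetric E d => ∫ y, f y ∂(P x.val))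

/-- Weak convergence `ν n → μ` with respect to the metric `d`. -/
def WeakTendstoFor {E : Type*} [MeasurableSpace E] (d : MetricOn E) (ν : ℕ → Measure E)
    (μ : Measure E) : Prop :=
  ∀ f : E → ℝ, IsBoundedContinuousFor d f →
    Tendsto (fun n => ∫ y, f y ∂(ν n)) atTop (𝓝 (∫ y, f y ∂μ))

open scoped ENNReal

/-! Write `g n` for `P ^ n f`, with `f` bounded and `d`-continuous. By Jensen and invariance the
second moments `∫ (g n)² dμ` decrease in `n`, hence converge. The drop from `m` to `m + k` is the
`μ`-average of the variance of `g m` under `P ^ k y`, so for large `m` and every `k`, most `y` have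
`g m` concentrated near `g (m + k) y` under `P ^ k y` (`Invariant.exists_forall_measure_le`).

The generalized coupling carries this concentration over to `x` (`exists_concentration_transfer`):
events rare under `pathLaw P y` are rare under `ξ`, there `g m` takes close values at `X k` and `Y
k`, and what is rare for `ξ.fst` is rare under `pathLaw P x`. Thus `g (m + k) x` is close to `g (m +
k) y` for most `y`, and averaging over `μ` gives `∫ f dμ`. Uniqueness follows because bounded
`d`-continuous functions separate Borel probability measures. -/

theorem MeasureTheory.Measure.AbsolutelyContinuous.exists_pos_forall_lt {α : Type*}
    [MeasurableSpace α] {μ ν : Measure α} [IsFiniteMeasure μ] [IsFiniteMeasure ν] (h : ν ≪ μ)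
    {ε : ℝ≥0∞} (hε : ε ≠ 0) : ∃ δ : ℝ≥0∞, 0 < δ ∧ ∀ s, μ s < δ → ν s < ε := by
  obtain ⟨δ, hδ, H⟩ := exists_pos_setLIntegral_lt_of_measure_lt
    (Measure.lintegral_rnDeriv_lt_top ν μ).ne hε
  refine ⟨δ, hδ, fun s hs => ?_⟩
  rw [← Measure.setLIntegral_rnDeriv h]
  exact H s hs

/-! ### Powers of the kernel and one-time marginals of the path law -/

section Kernel
variable {E : Type*} [MeasurableSpace E] (P : Kernel E E) [IsMarkovKernel P]

instance ProbabilityTheory.Kernel.isMarkovKernel_pow (n : ℕ) : IsMarkovKernel (P ^ n) := by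
  induction n with
  | zero => exact inferInstanceAs (IsMarkovKernel Kernel.id)
  | succ n ih => rw [pow_succ]; exact inferInstanceAs (IsMarkovKernel ((P ^ n) ∘ₖ P))

theorem ProbabilityTheory.Kernel.Invariant.pow {P : Kernel E E} {μ : Measure E}
    (h : Kernel.Invariant P μ) (n : ℕ) :
    Kernel.Invariant (P ^ n) μ := by
  induction n with
  | zero => exact Measure.id_comp
  | succ n ih => rw [pow_succ]; exact Kernel.Invariant.comp ih h

theorem pathLaw_map_eval (x : E) (n : ℕ) :
    (pathLaw P x).map (fun ω => ω n) = (P ^ n) x := by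
  set κ : (n : ℕ) → Kernel (Finset.Iic n → E) E :=
    fun n => P.comap (fun h : Finset.Iic n → E => h ⟨n, Finset.mem_Iic.2 le_rfl⟩)
      (measurable_pi_apply _)
  have key : ∀ n, (Kernel.traj (X := fun _ => E) κ 0).map (fun ω => ω n)
      = (P ^ n).comap (fun h : Finset.Iic 0 → E => h ⟨0, Finset.mem_Iic.2 le_rfl⟩)
        (measurable_pi_apply _) := by
    intro n
    induction n with
    | zero =>
      have h0 : (fun ω : ℕ → E => ω 0) =
        (fun h : Finset.Iic 0 → E => h ⟨0, Finset.mem_Iic.2 le_rfl⟩) ∘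
          (Preorder.frestrictLe (π := fun _ => E) 0) := rfl
      rw [h0, Kernel.map_comp_right _ (Preorder.measurable_frestrictLe 0) (by fun_prop),
        Kernel.traj_map_frestrictLe,
        Kernel.partialTraj_self, Kernel.id_map (by fun_prop)]
      ext h s hs
      rw [Kernel.deterministic_apply, Kernel.comap_apply]
      change _ = (Kernel.id : Kernel E E) _ _
      rw [Kernel.id_apply]
    | succ n ih =>
      have h1 : (fun ω : ℕ → E => ω n) =
        (fun h : Finset.Iic n → E => h ⟨n, Finset.mem_Iic.2 le_rfl⟩) ∘
          (Preorder.frestrictLe (π := fun _ => E) n) := rfl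
      rw [h1, Kernel.map_comp_right _ (Preorder.measurable_frestrictLe n) (by fun_prop),
        Kernel.traj_map_frestrictLe] at ih
      rw [← Kernel.traj_comp_partialTraj (X := fun _ => E) (κ := κ) (Nat.zero_le n), Kernel.map_comp,
        Kernel.map_traj_succ_self, pow_succ']
      ext h s hs
      rw [Kernel.comap_apply]
      change _ = (P ∘ₖ (P ^ n)) _ _
      have ih' := congrArg (fun K => K h) ih
      simp only [Kernel.comap_apply] at ih'
      rw [Kernel.comp_apply' _ _ _ hs, Kernel.comp_apply' _ _ _ hs, ← ih',
        Kernel.map_apply _ (by fun_prop), lintegral_map (Kernel.measurable_coe P hs) (by fun_prop)]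
      rfl
  have := congrArg (fun K => K (fun _ => x)) (key n)
  simpa [pathLaw, Kernel.map_apply _ (measurable_pi_apply n), Kernel.comap_apply] using this

instance (x : E) : IsProbabilityMeasure (pathLaw P x) := by
  unfold pathLaw; infer_instance

theorem pathLaw_eval_preimage (x : E) (n : ℕ) {s : Set E} (hs : MeasurableSet s) :
    pathLaw P x {ω | ω n ∈ s} = (P ^ n) x s := by
  rw [← pathLaw_map_eval, Measure.map_apply (measurable_pi_apply n) hs]; rfl
end Kernel

/-! ### Continuity with respect to the second metric -/

section Metric
variable {E : Type*} {d : MetricOn E}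

theorem continuous_withMetric_of [TopologicalSpace E]
    (hd : Continuous (fun p : E × E => d.dist p.1 p.2)) :
    Continuous (WithMetric.of : E → WithMetric E d) := by
  refine continuous_iff_continuousAt.2 fun a => tendsto_iff_dist_tendsto_zero.2 ?_
  have : Tendsto (fun x => d.dist x a) (𝓝 a) (𝓝 (d.dist a a)) :=
    (hd.comp (by fun_prop : Continuous fun x : E => (x, a))).tendsto a
  rwa [d.dist_self] at this

/-- Only `y` has to lie in `K`: in the coupling, tightness controls `Y k` but not `X k`. -/
theorem exists_pos_forall_dist_lt_of_isCompact [TopologicalSpace E]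
    (hd : Continuous (fun p : E × E => d.dist p.1 p.2)) {g : E → ℝ}
    (hg : Continuous (fun w : WithMetric E d => g w.val)) {K : Set E} (hK : IsCompact K)
    {ε : ℝ} (hε : 0 < ε) :
    ∃ r > 0, ∀ x, ∀ y ∈ K, d.dist x y ≤ r → |g x - g y| < ε := by
  have hK' := hK.image (continuous_withMetric_of hd)
  have := hK'.uniformContinuousAt_of_continuousAt (f := fun w : WithMetric E d => g w.val)
    (fun a _ => hg.continuousAt) (Metric.dist_mem_uniformity hε)
  obtain ⟨r, hr, H⟩ := Metric.mem_uniformity_dist.1 this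
  refine ⟨r / 2, half_pos hr, fun x y hy hxy => ?_⟩
  have h1 : dist (WithMetric.of y : WithMetric E d) (WithMetric.of x) < r := by
    rw [dist_comm]; exact lt_of_le_of_lt hxy (half_lt_self hr)
  have := H h1 (Set.mem_image_of_mem _ hy)
  rw [abs_sub_comm]; exact this

end Metric

/-! ### Transfer of concentration through a generalized coupling -/

section Coupling
variable {E : Type*} [MetricSpace E] [TopologicalSpace.SeparableSpace E] [MeasurableSpace E]
  [BorelSpace E] {d : MetricOn E} {P : Kernel E E} [IsMarkovKernel P]

/-- The order of quantifiers matters: `δ` comes from absolute continuity alone, so `g` and `K` may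
later be chosen in terms of it; only `N` depends on them. The centre `b` may vary with `k`. -/
theorem exists_concentration_transfer (hd : Continuous (fun p : E × E => d.dist p.1 p.2))
    {x y : E} {ξ : Measure ((ℕ → E) × (ℕ → E))}
    (hξ : ξ ∈ generalizedCouplings (pathLaw P x) (pathLaw P y))
    (hx : pathLaw P x ≪ ξ.fst)
    (hlim : ∀ ε : ℝ, 0 < ε →
        Tendsto (fun n : ℕ => ξ {z | d.dist (z.1 n) (z.2 n) ≤ ε}) atTop (𝓝 1))
    {e : ℝ≥0∞} (he : e ≠ 0) :
    ∃ δ : ℝ≥0∞, 0 < δ ∧ ∀ g : E → ℝ, Continuous (fun w : WithMetric E d => g w.val) →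
      ∀ ε : ℝ, 0 < ε → ∀ K : Set E, IsCompact K → ∃ N : ℕ, ∀ k ≥ N, ∀ b : ℝ,
        (P ^ k) y Kᶜ < δ → (P ^ k) y {z | ε ≤ |g z - b|} < δ →
        (P ^ k) x {z | 2 * ε ≤ |g z - b|} < e := by
  have : SecondCountableTopology E := UniformSpace.secondCountable_of_separable E
  obtain ⟨hprob, -, hy⟩ := hξ
  obtain ⟨η, hη, H1⟩ := hx.exists_pos_forall_lt he
  have hη3 : η / 3 ≠ 0 := (ENNReal.div_pos hη.ne' (by simp)).ne'
  obtain ⟨δ, hδ, H2⟩ := hy.exists_pos_forall_lt hη3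
  refine ⟨δ, hδ, fun g hg ε hε K hK => ?_⟩
  obtain ⟨r, hr, H⟩ := exists_pos_forall_dist_lt_of_isCompact hd hg hK hε
  have hgc : Continuous g := hg.comp (continuous_withMetric_of hd)
  have hmeas : ∀ k, MeasurableSet {z : (ℕ → E) × (ℕ → E) | d.dist (z.1 k) (z.2 k) ≤ r} := by
    intro k
    have h1 : Measurable fun z : (ℕ → E) × (ℕ → E) => d.dist (z.1 k) (z.2 k) :=
      hd.measurable.comp (f := fun z : (ℕ → E) × (ℕ → E) => (z.1 k, z.2 k)) (by fun_prop)
    exact measurableSet_le h1 measurable_const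
  have hc : Tendsto (fun k => ξ {z | d.dist (z.1 k) (z.2 k) ≤ r}ᶜ) atTop (𝓝 0) := by
    have h1 := ENNReal.Tendsto.sub (tendsto_const_nhds (x := (1 : ℝ≥0∞))) (hlim r hr) (by simp)
    simp only [tsub_self] at h1
    refine h1.congr fun k => ?_
    rw [prob_compl_eq_one_sub (hmeas k)]
  obtain ⟨N, hN⟩ := eventually_atTop.1 (hc.eventually_lt_const (pos_iff_ne_zero.2 hη3))
  refine ⟨N, fun k hk b hKδ hbδ => ?_⟩
  have hms : ∀ c : ℝ, MeasurableSet {z | c ≤ |g z - b|} := fun c =>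
    measurableSet_le measurable_const (by fun_prop)
  rw [← pathLaw_eval_preimage P _ _ (hms _)]
  refine H1 _ ?_
  have hmk : ∀ {s : Set E}, MeasurableSet s → MeasurableSet {ω : ℕ → E | ω k ∈ s} :=
    fun hs => measurable_pi_apply k hs
  rw [← pathLaw_eval_preimage P _ _ hK.isClosed.measurableSet.compl] at hKδ
  rw [← pathLaw_eval_preimage P _ _ (hms _)] at hbδ
  have h1 := H2 _ hKδ
  have h2 := H2 _ hbδ
  rw [Measure.snd_apply (hmk hK.isClosed.measurableSet.compl)] at h1
  rw [Measure.snd_apply (hmk (hms _))] at h2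
  rw [Measure.fst_apply (hmk (hms _))]
  -- Three bad events of mass below `η / 3`: `Y k` leaves `K`, `g (Y k)` is far from `b`, or `X k`
  -- and `Y k` are more than `r` apart.
  refine lt_of_le_of_lt ((measure_mono ?_).trans ((measure_union_le _ _).trans
    (add_le_add_left (measure_union_le _ _) _)))
    (lt_of_lt_of_eq (ENNReal.add_lt_add (ENNReal.add_lt_add h1 h2) (hN k hk))
      (ENNReal.add_thirds η))
  rintro z hz
  by_contra hcon
  simp only [Set.mem_union, not_or, Set.mem_preimage, Set.mem_ofPred_eq, Set.mem_compl_iff,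
    not_not, not_le] at hcon hz
  obtain ⟨⟨hzK, hzb⟩, hzd⟩ := hcon
  have h3 := H _ _ hzK (not_lt.1 hzd)
  have h4 := abs_sub_le (g (z.1 k)) (g (z.2 k)) b
  linarith

end Coupling

theorem integrable_of_measurable_of_abs_le {α : Type*} [MeasurableSpace α] {ν : Measure α}
    [IsFiniteMeasure ν] {h : α → ℝ} (hm : Measurable h) {C : ℝ} (hC : ∀ x, |h x| ≤ C) :
    Integrable h ν :=
  Integrable.of_bound hm.aestronglyMeasurable C (Eventually.of_forall hC)

theorem integral_abs_le_add_mul_measureReal {α : Type*} [MeasurableSpace α] {ν : Measure α}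
    [IsProbabilityMeasure ν] {h : α → ℝ} (hm : Measurable h) {C s : ℝ} (hC : ∀ x, |h x| ≤ C)
    (hs : 0 ≤ s) : ∫ x, |h x| ∂ν ≤ s + C * ν.real {x | s < |h x|} := by
  have hA : MeasurableSet {x | s < |h x|} := measurableSet_lt measurable_const (by fun_prop)
  have hi : Integrable ({x | s < |h x|}.indicator fun _ => C) ν :=
    (integrable_const C).indicator hA
  calc ∫ x, |h x| ∂ν ≤ ∫ x, (s + {x | s < |h x|}.indicator (fun _ => C) x) ∂ν := by
        refine integral_mono (integrable_of_measurable_of_abs_le hm hC).abs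
          ((integrable_const s).add hi) fun x => ?_
        by_cases hx : s < |h x|
        · simpa [hx] using le_add_of_nonneg_of_le hs (hC x)
        · simpa [hx] using not_lt.1 hx
    _ = s + C * ν.real {x | s < |h x|} := by
        rw [integral_add (integrable_const s) hi, integral_indicator_const _ hA]
        simp [mul_comm]

/-! ### Invariant measures and decay of conditional variances -/

section Kernel
variable {E : Type*} [MeasurableSpace E] {P : Kernel E E} {μ : Measure E}

theorem ProbabilityTheory.Kernel.Invariant.integral_integral [IsFiniteMeasure μ]
    (hμ : Kernel.Invariant P μ)
    {h : E → ℝ} (hh : Integrable h μ) : ∫ x, ∫ y, h y ∂(P x) ∂μ = ∫ y, h y ∂μ := by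
  rcases isEmpty_or_nonempty E with hE | ⟨⟨x₀⟩⟩
  · simp [Measure.eq_zero_of_isEmpty μ]
  · have h1 : (P ∘ₖ Kernel.const E μ) x₀ = μ := by rw [hμ.comp_const, Kernel.const_apply]
    have h2 := Kernel.integral_comp (κ := Kernel.const E μ) (η := P) (a := x₀) (f := h)
      (by rwa [h1])
    rw [h1, Kernel.const_apply] at h2
    exact h2.symm

theorem ProbabilityTheory.Kernel.Invariant.meas_ge_le_div [IsFiniteMeasure μ]
    (hμ : Kernel.Invariant P μ) {s : Set E} (hs : MeasurableSet s) {δ : ℝ≥0∞} (hδ : δ ≠ 0)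
    (hδ' : δ ≠ ∞) : μ {y | δ ≤ P y s} ≤ μ s / δ := by
  refine (meas_ge_le_lintegral_div (Kernel.measurable_coe P hs).aemeasurable hδ hδ').trans_eq ?_
  conv_rhs => rw [← hμ.def, Measure.bind_apply hs P.aemeasurable]

variable {f : E → ℝ} {C : ℝ}

theorem measurable_integral_pow (hf : Measurable f) (n : ℕ) :
    Measurable fun x => ∫ y, f y ∂((P ^ n) x) :=
  hf.stronglyMeasurable.integral_kernel.measurable

variable [IsMarkovKernel P]

theorem abs_integral_pow_le (hC : ∀ x, |f x| ≤ C) (n : ℕ) (x : E) :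
    |∫ y, f y ∂((P ^ n) x)| ≤ C := by
  have := norm_integral_le_of_norm_le_const (μ := (P ^ n) x) (f := f) (C := C)
    (Eventually.of_forall hC)
  simpa using this

theorem integral_pow_add (hf : Measurable f) (hC : ∀ x, |f x| ≤ C) (m k : ℕ) (x : E) :
    ∫ y, f y ∂((P ^ (m + k)) x) = ∫ z, ∫ y, f y ∂((P ^ m) z) ∂((P ^ k) x) := by
  rw [pow_add]
  have : IsFiniteMeasure (((P ^ m) ∘ₖ (P ^ k)) x) := inferInstance
  exact Kernel.integral_comp (integrable_of_measurable_of_abs_le hf hC)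

/-- The variance, under the `k`-step transition probability from `y`, of `P ^ m f`. -/
theorem integral_sq_sub_integral_pow (hf : Measurable f) (hC : ∀ x, |f x| ≤ C) (m k : ℕ)
    (y : E) :
    ∫ z, ((∫ w, f w ∂((P ^ m) z)) - ∫ w, f w ∂((P ^ (m + k)) y)) ^ 2 ∂((P ^ k) y) =
      ∫ z, (∫ w, f w ∂((P ^ m) z)) ^ 2 ∂((P ^ k) y) - (∫ w, f w ∂((P ^ (m + k)) y)) ^ 2 := by
  have hgm := measurable_integral_pow (P := P) hf m
  have hgC := abs_integral_pow_le (P := P) hC m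
  have hadd := integral_pow_add (P := P) hf hC m k y
  set g : E → ℝ := fun z => ∫ w, f w ∂((P ^ m) z)
  set b := ∫ w, f w ∂((P ^ (m + k)) y)
  have h1 : Integrable g ((P ^ k) y) := integrable_of_measurable_of_abs_le hgm hgC
  have h2 : Integrable (fun z => g z ^ 2) ((P ^ k) y) :=
    integrable_of_measurable_of_abs_le (C := C ^ 2) (by fun_prop) fun z => by
      rw [abs_pow]; exact pow_le_pow_left₀ (abs_nonneg _) (hgC z) 2
  have h3 : (fun z => (g z - b) ^ 2) = fun z => (g z ^ 2 - 2 * b * g z) + b ^ 2 :=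
    funext fun z => by ring
  have h4 : Integrable (fun z => g z ^ 2 - 2 * b * g z) ((P ^ k) y) := h2.sub (h1.const_mul _)
  change ∫ z, (g z - b) ^ 2 ∂((P ^ k) y) = ∫ z, g z ^ 2 ∂((P ^ k) y) - b ^ 2
  rw [h3, integral_add h4 (integrable_const _),
    integral_sub h2 (h1.const_mul _), integral_const_mul, ← hadd]
  simp
  ring

/-- Along an invariant measure, `P ^ m f` evaluated at time `k` is close to the conditional
expectation `P ^ (m + k) f` at time `0`, uniformly in `k`, once `m` is large. -/
theorem ProbabilityTheory.Kernel.Invariant.exists_forall_measure_le [IsProbabilityMeasure μ]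
    (hμ : Kernel.Invariant P μ) (hf : Measurable f) (hC : ∀ x, |f x| ≤ C)
    {ε δ e : ℝ} (hε : 0 < ε) (hδ : 0 < δ) (he : 0 < e) :
    ∃ m : ℕ, ∀ k : ℕ, μ.real {y | ENNReal.ofReal δ ≤ (P ^ k) y {z |
      ε ≤ |(∫ w, f w ∂((P ^ m) z)) - ∫ w, f w ∂((P ^ (m + k)) y)|}} ≤ e := by
  set g : ℕ → E → ℝ := fun n z => ∫ w, f w ∂((P ^ n) z)
  have hgm : ∀ n, Measurable (g n) := fun n => measurable_integral_pow hf n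
  have hgC : ∀ n x, |g n x| ≤ C := fun n => abs_integral_pow_le hC n
  have hg2 : ∀ n x, |g n x ^ 2| ≤ C ^ 2 := fun n x => by
    rw [abs_pow]; exact pow_le_pow_left₀ (abs_nonneg _) (hgC n x) 2
  have hI : ∀ n (ν : Measure E) [IsProbabilityMeasure ν], Integrable (fun z => g n z ^ 2) ν :=
    fun n ν _ => integrable_of_measurable_of_abs_le (by fun_prop) (hg2 n)
  set V : ℕ → ℕ → E → ℝ := fun m k y => ∫ z, (g m z - g (m + k) y) ^ 2 ∂((P ^ k) y)
  have hVeq : ∀ m k y, V m k y = ∫ z, g m z ^ 2 ∂((P ^ k) y) - g (m + k) y ^ 2 :=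
    fun m k y => integral_sq_sub_integral_pow hf hC m k y
  have hV0 : ∀ m k y, 0 ≤ V m k y := fun m k y => integral_nonneg fun z => sq_nonneg _
  have hVI1 : ∀ m k, Integrable (fun y => ∫ z, g m z ^ 2 ∂((P ^ k) y)) μ := fun m k =>
    integrable_of_measurable_of_abs_le
      (measurable_integral_pow (f := fun z => g m z ^ 2) (by fun_prop) k)
      (abs_integral_pow_le (hg2 m) k)
  have hVI : ∀ m k, Integrable (V m k) μ := fun m k => by
    have : V m k = fun y => ∫ z, g m z ^ 2 ∂((P ^ k) y) - g (m + k) y ^ 2 := funext (hVeq m k)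
    rw [this]
    exact (hVI1 m k).sub (hI _ μ)
  set a : ℕ → ℝ := fun n => ∫ y, g n y ^ 2 ∂μ
  have hVa : ∀ m k, ∫ y, V m k y ∂μ = a m - a (m + k) := fun m k => by
    simp_rw [hVeq]
    rw [integral_sub (hVI1 m k) (hI _ μ), (hμ.pow k).integral_integral (hI m μ)]
  have hanti : Antitone a := antitone_nat_of_succ_le fun n => by
    have := integral_nonneg (μ := μ) (f := V n 1) (hV0 n 1)
    rw [hVa] at this
    linarith
  have hbdd : BddBelow (Set.range a) :=
    ⟨0, by rintro _ ⟨n, rfl⟩; exact integral_nonneg fun y => sq_nonneg _⟩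
  -- Chebyshev under `P ^ k y` costs `ε ^ 2 * δ`, Markov under `μ` costs `e`.
  have hpos : 0 < e * (ε ^ 2 * δ) := by positivity
  obtain ⟨m, hm⟩ := ((tendsto_atTop_ciInf hanti hbdd).eventually_lt_const
    (lt_add_of_pos_right (⨅ i, a i) hpos)).exists
  refine ⟨m, fun k => ?_⟩
  have hle : ∫ y, V m k y ∂μ ≤ e * (ε ^ 2 * δ) := by
    rw [hVa]; linarith [ciInf_le hbdd (m + k)]
  have hsub : {y | ENNReal.ofReal δ ≤ (P ^ k) y {z | ε ≤ |g m z - g (m + k) y|}} ⊆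
      {y | ε ^ 2 * δ ≤ V m k y} := by
    intro y hy
    have h1 := mul_meas_ge_le_integral_of_nonneg (μ := (P ^ k) y)
      (f := fun z => (g m z - g (m + k) y) ^ 2) (Eventually.of_forall fun z => sq_nonneg _)
      (integrable_of_measurable_of_abs_le (C := (C + C) ^ 2) (by fun_prop) fun z => by
        rw [abs_pow]
        exact pow_le_pow_left₀ (abs_nonneg _)
          ((abs_sub _ _).trans (add_le_add (hgC _ _) (hgC _ _))) 2) (ε ^ 2)
    have h2 : {z | ε ^ 2 ≤ (g m z - g (m + k) y) ^ 2} = {z | ε ≤ |g m z - g (m + k) y|} := by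
      ext z
      change ε ^ 2 ≤ _ ↔ ε ≤ _
      rw [← sq_abs (g m z - _), pow_le_pow_iff_left₀ hε.le (abs_nonneg _) two_ne_zero]
    rw [h2] at h1
    have h3 : δ ≤ ((P ^ k) y).real {z | ε ≤ |g m z - g (m + k) y|} :=
      (ENNReal.ofReal_le_iff_le_toReal (measure_ne_top _ _)).1 hy
    exact (mul_le_mul_of_nonneg_left h3 (sq_nonneg ε)).trans h1
  have h4 := mul_meas_ge_le_integral_of_nonneg (μ := μ) (Eventually.of_forall (hV0 m k))
    (hVI m k) (ε ^ 2 * δ)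
  have h5 : μ.real {y | ε ^ 2 * δ ≤ V m k y} ≤ e := by
    refine le_of_mul_le_mul_left (h4.trans (hle.trans_eq (mul_comm _ _))) (by positivity)
  exact (measureReal_mono hsub).trans h5

end Kernel

theorem continuous_integral_pow_withMetric {E : Type*} [MeasurableSpace E] {d : MetricOn E}
    {P : Kernel E E} [IsMarkovKernel P] (hP : IsFellerFor d P) {f : E → ℝ} (hfm : Measurable f)
    (hf : IsBoundedContinuousFor d f) (n : ℕ) :
    Continuous fun w : WithMetric E d => ∫ y, f y ∂((P ^ n) w.val) := by
  obtain ⟨⟨C, hC⟩, hfc⟩ := hf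
  induction n with
  | zero =>
    convert hfc using 2 with w
    change ∫ y, f y ∂((Kernel.id : Kernel E E) w.val) = _
    rw [Kernel.id_apply, integral_dirac' _ _ hfm.stronglyMeasurable]
  | succ n ih =>
    have h := hP _ ⟨⟨C, abs_integral_pow_le (P := P) hC n⟩, ih⟩
    convert h using 2 with w
    rw [integral_pow_add hfm hC n 1, pow_one]

/-! ### Weak convergence and uniqueness -/

section Main
variable {E : Type*} [MetricSpace E] [CompleteSpace E] [TopologicalSpace.SeparableSpace E]
  [MeasurableSpace E] [BorelSpace E] {d : MetricOn E}

theorem weakTendstoFor_of_generalizedCouplings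
    (hd : Continuous (fun p : E × E => d.dist p.1 p.2))
    {P : Kernel E E} [IsMarkovKernel P] (hP : IsFellerFor d P) {μ : Measure E}
    [IsProbabilityMeasure μ] (hμ : Kernel.Invariant P μ) {x : E}
    (hξ : ∀ y : E, ∃ ξ ∈ generalizedCouplings (pathLaw P x) (pathLaw P y),
      pathLaw P x ≪ ξ.fst ∧ ∀ ε : ℝ, 0 < ε →
        Tendsto (fun n : ℕ => ξ {z | d.dist (z.1 n) (z.2 n) ≤ ε}) atTop (𝓝 1)) :
    WeakTendstoFor d (fun n => (P ^ n) x) μ := by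
  have : SecondCountableTopology E := UniformSpace.secondCountable_of_separable E
  intro f hf
  have hfm : Measurable f := (hf.2.comp (continuous_withMetric_of hd)).measurable
  obtain ⟨C, hC⟩ := hf.1
  have hC0 : 0 ≤ C := (abs_nonneg _).trans (hC x)
  have hgm : ∀ n, Measurable fun z => ∫ w, f w ∂((P ^ n) z) := measurable_integral_pow hfm
  have hgC : ∀ n z, |∫ w, f w ∂((P ^ n) z)| ≤ C := abs_integral_pow_le hC
  have hgc := continuous_integral_pow_withMetric hP hfm hf
  suffices H : ∀ e : ℝ, 0 < e → ∃ N : ℕ, ∀ n ≥ N,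
      |∫ y, f y ∂((P ^ n) x) - ∫ y, f y ∂μ| ≤ (2 + 8 * C) * e by
    refine Metric.tendsto_atTop'.2 fun r hr => ?_
    obtain ⟨N, hN⟩ := H (r / (2 * (2 + 8 * C))) (by positivity)
    refine ⟨N, fun n hn => lt_of_le_of_lt (hN n hn.le) ?_⟩
    have : (2 + 8 * C) * (r / (2 * (2 + 8 * C))) = r / 2 := by field_simp
    linarith
  intro e he
  have hlt : 1 - ENNReal.ofReal e < μ Set.univ := by
    rw [measure_univ]
    exact ENNReal.sub_lt_self ENNReal.one_ne_top one_ne_zero (by simpa using he)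
  have hδ : ∀ y, ∃ δ : ℝ≥0∞, 0 < δ ∧
      ∀ g : E → ℝ, Continuous (fun w : WithMetric E d => g w.val) →
      ∀ ε : ℝ, 0 < ε → ∀ K : Set E, IsCompact K → ∃ N : ℕ, ∀ k ≥ N, ∀ b : ℝ,
        (P ^ k) y Kᶜ < δ → (P ^ k) y {z | ε ≤ |g z - b|} < δ →
        (P ^ k) x {z | 2 * ε ≤ |g z - b|} < ENNReal.ofReal e := fun y => by
    obtain ⟨ξ, hξ1, hξ2, hξ3⟩ := hξ y
    exact exists_concentration_transfer hd hξ1 hξ2 hξ3 (by simpa using he)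
  choose δ hδ0 hδ using hδ
  -- Makes `δ y` uniform off a small set. The choice of `δ` need not be measurable; continuity from
  -- below along increasing sets holds for the outer measure. The same applies to `N` below.
  obtain ⟨j, hj⟩ : ∃ j : ℕ, 1 - ENNReal.ofReal e < μ {y | ((j : ℝ≥0∞) + 1)⁻¹ ≤ δ y} := by
    have hmono : Monotone fun j : ℕ => {y | ((j : ℝ≥0∞) + 1)⁻¹ ≤ δ y} := fun i j hij y hy =>
      (ENNReal.inv_le_inv.2 (by gcongr)).trans hy
    have hU : ⋃ j : ℕ, {y | ((j : ℝ≥0∞) + 1)⁻¹ ≤ δ y} = Set.univ := by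
      refine Set.eq_univ_of_forall fun y => Set.mem_iUnion.2 ?_
      obtain ⟨j, hj⟩ := ENNReal.exists_inv_nat_lt (hδ0 y).ne'
      exact ⟨j, (ENNReal.inv_le_inv.2 le_self_add).trans hj.le⟩
    have := tendsto_measure_iUnion_atTop (μ := μ) hmono
    rw [hU] at this
    exact (this.eventually_const_lt hlt).exists
  obtain ⟨η, hη, hηj⟩ : ∃ η : ℝ, 0 < η ∧ ENNReal.ofReal η = ((j : ℝ≥0∞) + 1)⁻¹ := by
    refine ⟨((j : ℝ) + 1)⁻¹, by positivity, ?_⟩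
    rw [ENNReal.ofReal_inv_of_pos (by positivity), ENNReal.ofReal_add (by positivity) zero_le_one]
    simp
  rw [← hηj] at hj
  obtain ⟨m, hm⟩ := hμ.exists_forall_measure_le hfm hC he hη he
  -- The tail `e * η` makes the set of `y` with `P ^ k y Kᶜ ≥ η` of `μ`-mass at most `e`, for all
  -- `k` at once.
  obtain ⟨K, hK, hKμ⟩ := isTightMeasureSet_iff_exists_isCompact_measure_compl_le.1
    (isTightMeasureSet_singleton (μ := μ)) (ENNReal.ofReal (e * η)) (by simpa using mul_pos he hη)
  have hKμ := hKμ μ rfl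
  choose N hN using fun y => hδ y (fun z => ∫ w, f w ∂((P ^ m) z)) (hgc m) e he K hK
  set S := {y | ENNReal.ofReal η ≤ δ y}
  obtain ⟨L, hL⟩ : ∃ L : ℕ, 1 - ENNReal.ofReal e < μ (S ∩ {y | N y ≤ L}) := by
    have hmono : Monotone fun L : ℕ => S ∩ {y | N y ≤ L} := fun i j hij y hy =>
      ⟨hy.1, le_trans hy.2 hij⟩
    have hU : ⋃ L : ℕ, S ∩ {y | N y ≤ L} = S :=
      Set.Subset.antisymm (Set.iUnion_subset fun _ => Set.inter_subset_left)
        fun y hy => Set.mem_iUnion.2 ⟨N y, hy, le_refl (N y)⟩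
    have := tendsto_measure_iUnion_atTop (μ := μ) hmono
    rw [hU] at this
    exact (this.eventually_const_lt hj).exists
  refine ⟨m + L, fun n hn => ?_⟩
  obtain ⟨k, rfl⟩ := Nat.exists_eq_add_of_le (le_of_add_le_left hn)
  have hk : L ≤ k := by omega
  set g : ℕ → E → ℝ := fun n z => ∫ w, f w ∂((P ^ n) z) with hg
  -- `2 * e` is the width of the concentration band at `x`; outside it, on mass at most `e`, the
  -- difference is at most `2 * C`.
  set s := (2 + 2 * C) * e
  set B := {y | |g (m + k) x - g (m + k) y| ≤ s}
  set D₁ := {y | ENNReal.ofReal η ≤ (P ^ k) y Kᶜ}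
  set D₂ := {y | ENNReal.ofReal η ≤ (P ^ k) y {z | e ≤ |g m z - g (m + k) y|}}
  have hdiff : ∀ (a b : ℕ) (y z : E), |g a y - g b z| ≤ 2 * C := fun a b y z =>
    (abs_sub _ _).trans ((add_le_add (hgC _ _) (hgC _ _)).trans_eq (two_mul C).symm)
  have hsub : S ∩ {y | N y ≤ L} ⊆ B ∪ (D₁ ∪ D₂) := by
    rintro y ⟨hyS, hyL⟩
    by_contra hcon
    simp only [Set.mem_union, not_or] at hcon
    obtain ⟨hyB, hy1, hy2⟩ := hcon
    refine hyB ?_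
    have h1 := hN y k (le_trans hyL hk) (g (m + k) y) ((not_le.1 hy1).trans_le hyS)
      ((not_le.1 hy2).trans_le hyS)
    have h2 := integral_abs_le_add_mul_measureReal (ν := (P ^ k) x)
      (h := fun z => g m z - g (m + k) y) ((hgm m).sub_const _) (fun z => hdiff m (m + k) z y)
      (s := 2 * e) (by positivity)
    have h3 : ((P ^ k) x).real {z | 2 * e ≤ |g m z - g (m + k) y|} ≤ e :=
      ENNReal.toReal_le_of_le_ofReal he.le h1.le
    have h3' : ((P ^ k) x).real {z | 2 * e < |g m z - g (m + k) y|} ≤ e :=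
      (measureReal_mono (Set.ofPred_subset_ofPred.2 fun z hz => le_of_lt hz)).trans h3
    have h4 : g (m + k) x - g (m + k) y = ∫ z, (g m z - g (m + k) y) ∂((P ^ k) x) := by
      rw [integral_sub (integrable_of_measurable_of_abs_le (hgm m) (hgC m)) (integrable_const _)]
      simp only [integral_const, probReal_univ, one_smul, hg]
      rw [integral_pow_add hfm hC m k x]
    change |_| ≤ s
    rw [h4]
    have h5 := mul_le_mul_of_nonneg_left h3' (by positivity : 0 ≤ 2 * C)
    have h6 := abs_integral_le_integral_abs (μ := (P ^ k) x) (f := fun z => g m z - g (m + k) y)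
    simp only [s]
    linarith
  have hBm : MeasurableSet B := measurableSet_le (by fun_prop) measurable_const
  have hD1 : μ.real D₁ ≤ e := by
    refine ENNReal.toReal_le_of_le_ofReal he.le (((hμ.pow k).meas_ge_le_div
      hK.isClosed.measurableSet.compl (by simpa using hη) ENNReal.ofReal_ne_top).trans ?_)
    refine ENNReal.div_le_of_le_mul ?_
    rwa [← ENNReal.ofReal_mul he.le]
  have hD2 : μ.real D₂ ≤ e := hm k
  have hT : 1 - e ≤ μ.real (S ∩ {y | N y ≤ L}) := by
    have h1 : ENNReal.ofReal (1 - e) ≤ μ (S ∩ {y | N y ≤ L}) := by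
      rw [ENNReal.ofReal_sub _ he.le, ENNReal.ofReal_one]; exact hL.le
    exact (ENNReal.ofReal_le_iff_le_toReal (measure_ne_top _ _)).1 h1
  -- One `e` each for the complement of `S ∩ {y | N y ≤ L}`, for `D₁` and for `D₂`.
  have hB : μ.real {y | s < |g (m + k) x - g (m + k) y|} ≤ 3 * e := by
    have h1 : {y | s < |g (m + k) x - g (m + k) y|} = Bᶜ := by
      ext y; exact (not_le (a := |g (m + k) x - g (m + k) y|) (b := s)).symm
    rw [h1, probReal_compl_eq_one_sub hBm]
    have h2 := measureReal_mono (μ := μ) hsub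
    have h3 := measureReal_union_le (μ := μ) B (D₁ ∪ D₂)
    have h4 := measureReal_union_le (μ := μ) D₁ D₂
    linarith
  have h1 := integral_abs_le_add_mul_measureReal (ν := μ)
    (h := fun y => g (m + k) x - g (m + k) y) ((hgm (m + k)).const_sub _)
    (fun y => hdiff _ _ x y) (s := s) (by positivity)
  have h2 : g (m + k) x - ∫ y, f y ∂μ = ∫ y, (g (m + k) x - g (m + k) y) ∂μ := by
    rw [integral_sub (integrable_const _)
      (integrable_of_measurable_of_abs_le (hgm (m + k)) (hgC (m + k)))]
    simp only [integral_const, probReal_univ, one_smul, hg]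
    rw [(hμ.pow (m + k)).integral_integral (integrable_of_measurable_of_abs_le hfm hC)]
  change |g (m + k) x - _| ≤ _
  rw [h2]
  have h3 := abs_integral_le_integral_abs (μ := μ) (f := fun y => g (m + k) x - g (m + k) y)
  have h4 := mul_le_mul_of_nonneg_left hB (by positivity : 0 ≤ 2 * C)
  have h5 : (2 + 8 * C) * e = s + 2 * C * (3 * e) := by simp only [s]; ring
  linarith

/-- By Lusin–Souslin, the continuous injection of the Polish space `E` into `WithMetric E d` is a
measurable embedding, so no Borel sets are lost in passing to the coarser topology. -/
theorem eq_of_forall_integral_eq_withMetric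
    (hd : Continuous (fun p : E × E => d.dist p.1 p.2)) {μ₁ μ₂ : Measure E}
    [IsProbabilityMeasure μ₁] [IsProbabilityMeasure μ₂]
    (h : ∀ f : E → ℝ, IsBoundedContinuousFor d f → ∫ y, f y ∂μ₁ = ∫ y, f y ∂μ₂) : μ₁ = μ₂ := by
  have : SecondCountableTopology E := UniformSpace.secondCountable_of_separable E
  let _ : MeasurableSpace (WithMetric E d) := borel _
  have : BorelSpace (WithMetric E d) := ⟨rfl⟩
  have hι := continuous_withMetric_of (d := d) hd
  have hemb : MeasurableEmbedding (WithMetric.of : E → WithMetric E d) :=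
    hι.measurableEmbedding fun a b hab => congrArg WithMetric.val hab
  have hmap : μ₁.map (WithMetric.of : E → WithMetric E d) = μ₂.map WithMetric.of := by
    have := Measure.isProbabilityMeasure_map (μ := μ₁) hι.measurable.aemeasurable
    have := Measure.isProbabilityMeasure_map (μ := μ₂) hι.measurable.aemeasurable
    refine ext_of_forall_integral_eq_of_IsFiniteMeasure fun f => ?_
    rw [hemb.integral_map, hemb.integral_map]
    exact h _ ⟨⟨‖f‖, fun x => f.norm_coe_le_norm _⟩, f.continuous⟩
  rw [← hemb.comap_map μ₁, hmap, hemb.comap_map]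

end Main

theorem corollary2p8 {E : Type*} [MetricSpace E] [CompleteSpace E]
    [TopologicalSpace.SeparableSpace E] [MeasurableSpace E] [BorelSpace E]
    (d : MetricOn E) (hd : IsAdmissibleMetric d)
    (P : Kernel E E) [IsMarkovKernel P] (hP : IsFellerFor d P)
    (hξ : ∀ x y : E, ∃ ξ ∈ generalizedCouplings (pathLaw P x) (pathLaw P y),
      (ξ.fst ≪ pathLaw P x ∧ pathLaw P x ≪ ξ.fst) ∧
      ∀ ε : ℝ, 0 < ε →
        Tendsto (fun n : ℕ => ξ {z | d.dist (z.1 n) (z.2 n) ≤ ε}) atTop (𝓝 1)) :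
    (∀ μ₁ μ₂ : Measure E, IsProbabilityMeasure μ₁ → IsProbabilityMeasure μ₂ →
      Kernel.Invariant P μ₁ → Kernel.Invariant P μ₂ → μ₁ = μ₂) ∧
    (∀ μ : Measure E, IsProbabilityMeasure μ → Kernel.Invariant P μ →
      ∀ x : E, WeakTendstoFor d (fun n => (P ^ n) x) μ) := by
  have key : ∀ μ : Measure E, IsProbabilityMeasure μ → Kernel.Invariant P μ →
      ∀ x : E, WeakTendstoFor d (fun n => (P ^ n) x) μ := fun μ _ hμ x =>
    weakTendstoFor_of_generalizedCouplings hd.continuous hP hμ fun y => by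
      obtain ⟨ξ, h1, h2, h3⟩ := hξ x y
      exact ⟨ξ, h1, h2.2, h3⟩
  refine ⟨fun μ₁ μ₂ h₁ h₂ hμ₁ hμ₂ => ?_, key⟩
  obtain ⟨x⟩ := μ₁.nonempty_of_neZero
  exact eq_of_forall_integral_eq_withMetric hd.continuous fun f hf =>
    tendsto_nhds_unique (key μ₁ h₁ hμ₁ x f hf) (key μ₂ h₂ hμ₂ x f hf)
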